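/- Let $G=(V,E)$ be a finite undirected loop-free multigraph (parallel edges allowed), and for each $v\in V$ let $\varphi_v:\mathbb Z_+\to\mathbb R$ be a discrete convex function, i.e. $\varphi_v(z+1)+\varphi_v(z-1)\ge 2\varphi_v(z)$ for every positive integer $z$. If every $\varphi_v$ can be evaluated in time polynomial in $|V|$ and $|E|$, then an orientation of $G$ (not necessarily acyclic) that minimizes $\sum_{v\in V}\varphi_v(\varrho(v))$ over all orientations of $G$, where $\varrho(v)$ is the indegree of $v$, can be computed in strongly polynomial time. Precisely: there is a single program for a random access machine that has a memory for natural numbers (constants, addition, truncated subtraction, comparison; used for indexing and counting) and a memory for real numbers (rational constants, the operations $+,-,\cdot,/$, comparison, each counted as one step), and that can call a procedure which returns $\varphi_v(z)$ for given $v$ and $z$. For every polynomial $p$ there are polynomials $q,r$ such that the following holds for every such $G$, given by $n=|V|$, $m=|E|$ and the numbers of the two ends of each edge, and for all discrete convex $\varphi_v$ $(v\in V)$: if evaluating $\varphi_v(z)$ takes time at most $p(n+m)$ for all $v\in V$ and all $0\le z\le m$, then the program halts after total time at most $q(n+m)$, including the time of all evaluations, with the heads of the edges of an optimal orientation as output.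 At each time the natural numbers in memory have at most $r(n+m)$ binary digits; and if the numbers $\varphi_v(z)$ ($v\in V$, $0\le z\le m$) are rational with at most $b$ binary digits each (numerator and denominator together), then at each time all numbers in the real memory are rational with at most $r(n+m+b)$ binary digits. -/

import Mathlib

universe u v

open scoped Graph

/-- `f : ℤ₊ → ℝ` is discrete convex. -/
def DiscreteConvex (f : ℕ → ℝ) : Prop :=
  ∀ z : ℕ, 0 < z → 2 * f z ≤ f (z + 1) + f (z - 1)

namespace Graph

variable {α : Type u} {β : Type v}

/-- An orientation of the multigraph `G`: every edge `e` is directed from one of its ends, `tail e`,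
to the other one, `head e`. No acyclicity is required. -/
structure Orientation (G : Graph α β) where
  tail : E(G) → V(G)
  head : E(G) → V(G)
  isLink : ∀ e : E(G), G.IsLink (e : β) (tail e : α) (head e : α)

namespace Orientation

variable {G : Graph α β}

/-- The indegree of `x`: the number of edges directed towards `x`. -/
noncomputable def indegree (D : G.Orientation) (x : V(G)) : ℕ :=
  Set.ncard {e : E(G) | D.head e = x}

/-- The objective `∑ φ_v (indegree v)` over all vertices `v`. -/
noncomputable def cost [Fintype V(G)] (φ : V(G) → ℕ → ℝ) (D : G.Orientation) : ℝ :=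
  ∑ x : V(G), φ x (D.indegree x)

/-- `D` minimizes the objective among all orientations of `G`. -/
def IsOptimal [Fintype V(G)] (φ : V(G) → ℕ → ℝ) (D : G.Orientation) : Prop :=
  ∀ D' : G.Orientation, D.cost φ ≤ D'.cost φ

end Orientation

/-- A description of a finite multigraph as the input of an algorithm: the vertices and the edges
are numbered, so that `n = |V|` and `m = |E|`, and for each edge number the numbers of its two ends
are listed, in any order. -/
structure Listing (G : Graph α β) (n m : ℕ) where
  vertex : Fin n ≃ V(G)
  edge : Fin m ≃ E(G)
  fst : Fin m → Fin n
  snd : Fin m → Fin n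
  isLink : ∀ j : Fin m,
    G.IsLink (edge j : β) (vertex (fst j) : α) (vertex (snd j) : α)

end Graph

/-! A random access machine with a memory for natural numbers (indices and counters) and a memory
for real numbers (the data). Each memory consists of arrays `0, 1, 2, …`, each array of cells
`0, 1, 2, …`; a program mentions only finitely many arrays. Real numbers can only be read, combined
by the four arithmetic operations, and compared; in particular there is no rounding and no way to
turn a real number into an address. The data functions `φ_v` are accessible only by evaluation. -/

namespace RealRAM

/-- The contents of the two memories: `nat a i` and `real a i` are the contents of cell `i` of the
array `a`. -/
structure Memory where
  nat : ℕ → ℕ → ℕ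
  real : ℕ → ℕ → ℝ

/-- A natural-number operand: a constant, or a cell of a given array; the address of the cell is an
operand again (indirect addressing). -/
inductive NatOperand where
  | const (c : ℕ)
  | cell (a : ℕ) (i : NatOperand)

/-- A real operand: a rational constant, or a cell of a given array. -/
inductive RealOperand where
  | const (q : ℚ)
  | cell (a : ℕ) (i : NatOperand)

def NatOperand.value (s : Memory) : NatOperand → ℕ
  | .const c => c
  | .cell a i => s.nat a (i.value s)

def RealOperand.value (s : Memory) : RealOperand → ℝ
  | .const q => (q : ℝ)
  | .cell a i => s.real a (i.value s)

/-- The operations on natural numbers: addition and truncated subtraction. -/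
inductive NatArith where
  | add
  | sub

def NatArith.apply : NatArith → ℕ → ℕ → ℕ
  | .add, x, y => x + y
  | .sub, x, y => x - y

/-- The operations on real numbers; division by zero returns zero. -/
inductive RealArith where
  | add
  | sub
  | mul
  | div

noncomputable def RealArith.apply : RealArith → ℝ → ℝ → ℝ
  | .add, x, y => x + y
  | .sub, x, y => x - y
  | .mul, x, y => x * y
  | .div, x, y => x / y

/-- Comparisons of two natural numbers or of two real numbers. -/
inductive Test where
  | natLT (x y : NatOperand)
  | realLE (x y : RealOperand)

def Test.holds (s : Memory) : Test → Prop
  | .natLT x y => x.value s < y.value s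
  | .realLE x y => x.value s ≤ y.value s

/-- Programs. `setNat a i op x y` stores `x op y` in cell `i` of the array `a` of natural numbers,
`setReal` does the same for real numbers, and `eval a i x z` stores the value `φ_x(z)`, where `x` is
the number of a vertex, in cell `i` of the array `a` of real numbers. -/
inductive Program where
  | skip
  | setNat (a : ℕ) (i : NatOperand) (op : NatArith) (x y : NatOperand)
  | setReal (a : ℕ) (i : NatOperand) (op : RealArith) (x y : RealOperand)
  | eval (a : ℕ) (i : NatOperand) (x z : NatOperand)
  | seq (P Q : Program)
  | ifElse (b : Test) (P Q : Program)
  | whileDo (b : Test) (P : Program)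

/-- The evaluation procedure available to a program: `value x z` is the number returned for the
arguments `x` and `z`, and `time x z` is the time that this evaluation takes. -/
structure Evaluator where
  value : ℕ → ℕ → ℝ
  time : ℕ → ℕ → ℕ

def Memory.setNat (s : Memory) (a i c : ℕ) : Memory where
  nat := Function.update s.nat a (Function.update (s.nat a) i c)
  real := s.real

def Memory.setReal (s : Memory) (a i : ℕ) (c : ℝ) : Memory where
  nat := s.nat
  real := Function.update s.real a (Function.update (s.real a) i c)

/-- A configuration: the programs that are still to be executed, in this order, and the memory. -/
structure Config where
  todo : List Program
  mem : Memory

/-- One step of the machine. -/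
noncomputable def step (O : Evaluator) : Config → Config
  | ⟨[], s⟩ => ⟨[], s⟩
  | ⟨.skip :: K, s⟩ => ⟨K, s⟩
  | ⟨.setNat a i op x y :: K, s⟩ =>
      ⟨K, s.setNat a (i.value s) (op.apply (x.value s) (y.value s))⟩
  | ⟨.setReal a i op x y :: K, s⟩ =>
      ⟨K, s.setReal a (i.value s) (op.apply (x.value s) (y.value s))⟩
  | ⟨.eval a i x z :: K, s⟩ =>
      ⟨K, s.setReal a (i.value s) (O.value (x.value s) (z.value s))⟩
  | ⟨.seq P Q :: K, s⟩ => ⟨P :: Q :: K, s⟩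
  | ⟨.ifElse b P Q :: K, s⟩ =>
      open Classical in ⟨(if b.holds s then P else Q) :: K, s⟩
  | ⟨.whileDo b P :: K, s⟩ =>
      open Classical in ⟨if b.holds s then P :: .whileDo b P :: K else K, s⟩

/-- The time charged for the next step: one unit, and for an evaluation also the time that the
evaluation procedure takes. (The nesting depth of operands is bounded in a fixed program, so
charging for it would change running times by a constant factor only.) -/
def stepTime (O : Evaluator) : Config → ℕ
  | ⟨[], _⟩ => 0
  | ⟨.eval _ _ x z :: _, s⟩ => 1 + O.time (x.value s) (z.value s)
  | ⟨_ :: _, _⟩ => 1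

/-- The configuration after `t` steps of the program `P` started on the memory `s`. -/
noncomputable def configAt (O : Evaluator) (P : Program) (s : Memory) (t : ℕ) : Config :=
  (step O)^[t] ⟨[P], s⟩

/-- The running time of the first `t` steps. -/
noncomputable def timeUntil (O : Evaluator) (P : Program) (s : Memory) (t : ℕ) : ℕ :=
  ∑ k ∈ Finset.range t, stepTime O (configAt O P s k)

end RealRAM

/-- The real number `x` is rational, and its numerator and denominator (in lowest terms) have at
most `b` binary digits together. -/
def HasRatSizeLE (x : ℝ) (b : ℕ) : Prop :=
  ∃ q : ℚ, (q : ℝ) = x ∧ q.num.natAbs.size + q.den.size ≤ b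

namespace Graph

open RealRAM

variable {α : Type u} {β : Type v} {G : Graph α β} {n m : ℕ}

/-- The initial memory: cells `0` and `1` of the array `0` hold `|V|` and `|E|`, the arrays `1` and
`2` hold the numbers of the two ends of each edge, and all other cells are zero. -/
def Listing.input (L : G.Listing n m) : Memory where
  nat
    | 0, 0 => n
    | 0, 1 => m
    | 1, j => if h : j < m then (L.fst ⟨j, h⟩ : ℕ) else 0
    | 2, j => if h : j < m then (L.snd ⟨j, h⟩ : ℕ) else 0
    | _, _ => 0
  real _ _ := 0

/-- The orientation `D` is written in the memory `s`: cell `j` of the array `3` holds the number of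
the head of the `j`-th edge. -/
def Listing.IsOutput (L : G.Listing n m) (D : G.Orientation) (s : Memory) : Prop :=
  ∀ j : Fin m, s.nat 3 j = (L.vertex.symm (D.head (L.edge j)) : ℕ)

/-- The procedure that evaluates the functions `φ_v`, the evaluation of `φ_v(z)` taking time
`τ v z`. Arguments that are not vertex numbers return `0`. -/
def Listing.evaluator (L : G.Listing n m) (φ : V(G) → ℕ → ℝ) (τ : V(G) → ℕ → ℕ) : Evaluator where
  value x z := if h : x < n then φ (L.vertex ⟨x, h⟩) z else 0
  time x z := if h : x < n then τ (L.vertex ⟨x, h⟩) z else 0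

end Graph

/-! Optimality is certified by a potential `p`: `p x` is a subgradient of `φ_x` at the indegree of
`x`, and every edge points to an end of smaller or equal potential. Since `∑ p x * indegree x` is
the sum of the potentials of the heads, such an orientation minimizes the linearized objective,
hence the convex one (`isOptimal_of_potential`).

The edges are inserted one at a time, keeping a certificate. For a new edge, let `t` have the
smallest marginal cost `μ` among the marked vertices, i.e. those from which an end of the edge can
be reached. Raising `p` to at least `μ` on the marked set keeps the certificate: `μ` is at most
every marked marginal, and no edge enters the marked set from outside (`exists_isReversal`). Now `t`
has potential exactly `μ`, no marked vertex has less, and potentials do not increase along edges; so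
the path from `t` to an end `c` is tight and may be reversed (`IsReversal.next`). Directing the new
edge to `c` leaves a net change of one, at `t`, and `μ` is still a subgradient there
(`IsReversal.isPartialOptimum`).

Potentials occur only in the proof. The program computes values of `φ` and differences of two of
them, so real numbers stay of linear size. Natural numbers at most double in a step, so polynomial
time bounds their digits. Running times come from a total-correctness calculus, `Wp`. -/

namespace RealRAM

/-! ### Runs with time bounds, and rules for total correctness. -/

/-- All cells of the real memory hold elements of `S`. -/
def Memory.RealIn (s : Memory) (S : Set ℝ) : Prop :=
  ∀ a i, s.real a i ∈ S

/-- The machine gets from one configuration to another within time `T`, and with all real cells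
in `S` throughout. -/
inductive RunsTo (O : Evaluator) (S : Set ℝ) : ℕ → Config → Config → Prop
  | refl (T : ℕ) (c : Config) (h : c.mem.RealIn S) : RunsTo O S T c c
  | step (τ T : ℕ) (c c' : Config) (h : c.mem.RealIn S) (h1 : 1 ≤ τ) (hτ : stepTime O c ≤ τ)
      (hc : RunsTo O S T (step O c) c') : RunsTo O S (τ + T) c c'

namespace RunsTo

variable {O : Evaluator} {S : Set ℝ} {T T' : ℕ} {c c' c'' : Config}

theorem realIn_right (h : RunsTo O S T c c') : c'.mem.RealIn S := by
  induction h with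
  | refl T c h => exact h
  | step τ T c c' h h1 hτ hc ih => exact ih

theorem mono (h : RunsTo O S T c c') (hT : T ≤ T') : RunsTo O S T' c c' := by
  induction h generalizing T' with
  | refl T c h => exact refl _ _ h
  | step τ T c c' h h1 hτ hc ih =>
    obtain ⟨d, rfl⟩ := Nat.exists_eq_add_of_le hT
    rw [add_assoc]
    exact step _ _ _ _ h h1 hτ (ih (Nat.le_add_right _ _))

theorem trans (h : RunsTo O S T c c') (h' : RunsTo O S T' c' c'') :
    RunsTo O S (T + T') c c'' := by
  induction h with
  | refl T c h => exact h'.mono (Nat.le_add_left _ _)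
  | step τ T c c' h h1 hτ hc ih =>
    rw [add_assoc]
    exact step _ _ _ _ h h1 hτ (ih h')

/-- Each step is charged at least one unit, so `T` bounds the number of steps as well as the running
time. The step count is what the bound on the natural numbers needs. -/
theorem exists_iterate (h : RunsTo O S T c c') :
    ∃ t ≤ T, (RealRAM.step O)^[t] c = c' ∧
      ∑ k ∈ Finset.range t, stepTime O ((RealRAM.step O)^[k] c) ≤ T ∧
      ∀ k ≤ t, ((RealRAM.step O)^[k] c).mem.RealIn S := by
  induction h with
  | refl T c h =>
    refine ⟨0, Nat.zero_le _, rfl, by simp, ?_⟩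
    intro k hk
    obtain rfl : k = 0 := by omega
    exact h
  | step τ T c c' h h1 hτ hc ih =>
    obtain ⟨t, ht, he, hs, hr⟩ := ih
    refine ⟨t + 1, by omega, by rwa [Function.iterate_succ_apply], ?_, ?_⟩
    · rw [Finset.sum_range_succ']
      simp only [Function.iterate_succ_apply, Function.iterate_zero, id]
      omega
    · intro k hk
      cases k with
      | zero => exact h
      | succ k => exact hr k (by omega)

end RunsTo

/-- Total correctness with a time bound: started on `s`, the program `P` halts within time `T` on a
memory that satisfies `Q`, and real cells stay in `S`. -/
def Wp (O : Evaluator) (S : Set ℝ) (P : Program) (T : ℕ) (Q : Memory → Prop) (s : Memory) : Prop :=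
  s.RealIn S → ∀ K, ∃ s', Q s' ∧ RunsTo O S T ⟨P :: K, s⟩ ⟨K, s'⟩

namespace Wp

variable {O : Evaluator} {S : Set ℝ} {P P' : Program} {T T' : ℕ} {Q R : Memory → Prop} {s : Memory}

theorem mono (h : Wp O S P T Q s) (hT : T ≤ T') (hQ : ∀ s', Q s' → R s') : Wp O S P T' R s := by
  intro hs K
  obtain ⟨s', hq, hr⟩ := h hs K
  exact ⟨s', hQ s' hq, hr.mono hT⟩

theorem skip (h : Q s) : Wp O S .skip 1 Q s := fun hs _ =>
  ⟨s, h, .step 1 0 _ _ hs le_rfl le_rfl (.refl _ _ hs)⟩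

theorem setNat {a : ℕ} {i : NatOperand} {op : NatArith} {x y : NatOperand}
    (h : Q (s.setNat a (i.value s) (op.apply (x.value s) (y.value s)))) :
    Wp O S (.setNat a i op x y) 1 Q s := fun hs _ =>
  ⟨_, h, .step 1 0 _ _ hs le_rfl le_rfl (.refl _ _ hs)⟩

theorem _root_.RealRAM.Memory.RealIn.setReal (hs : s.RealIn S) {a i : ℕ} {c : ℝ} (hc : c ∈ S) :
    (s.setReal a i c).RealIn S := by
  intro a' i'
  by_cases ha : a' = a
  · subst ha
    by_cases hi : i' = i
    · subst hi
      simpa [Memory.setReal] using hc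
    · simpa [Memory.setReal, hi] using hs a' i'
  · simpa [Memory.setReal, ha] using hs a' i'

theorem setReal {a : ℕ} {i : NatOperand} {op : RealArith} {x y : RealOperand}
    (hS : op.apply (x.value s) (y.value s) ∈ S)
    (h : Q (s.setReal a (i.value s) (op.apply (x.value s) (y.value s)))) :
    Wp O S (.setReal a i op x y) 1 Q s := fun hs _ =>
  ⟨_, h, .step 1 0 _ _ hs le_rfl le_rfl (.refl _ _ (hs.setReal hS))⟩

theorem eval {a : ℕ} {i x z : NatOperand} {E : ℕ}
    (hS : O.value (x.value s) (z.value s) ∈ S) (hE : O.time (x.value s) (z.value s) ≤ E)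
    (h : Q (s.setReal a (i.value s) (O.value (x.value s) (z.value s)))) :
    Wp O S (.eval a i x z) (1 + E) Q s := fun hs _ =>
  ⟨_, h, .step (1 + E) 0 _ _ hs (by omega) (Nat.add_le_add_left hE 1)
    (.refl _ _ (hs.setReal hS))⟩

theorem seq (h : Wp O S P T (Wp O S P' T' Q) s) : Wp O S (.seq P P') (1 + (T + T')) Q s := by
  intro hs K
  obtain ⟨s', h', hr⟩ := h hs (P' :: K)
  obtain ⟨s'', hq, hr'⟩ := h' hr.realIn_right K
  exact ⟨s'', hq, .step 1 _ _ _ hs le_rfl le_rfl (hr.trans hr')⟩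

theorem ifElse {b : Test} (h : b.holds s → Wp O S P T Q s) (h' : ¬ b.holds s → Wp O S P' T Q s) :
    Wp O S (.ifElse b P P') (1 + T) Q s := by
  intro hs K
  by_cases hb : b.holds s
  · obtain ⟨s', hq, hr⟩ := h hb hs K
    exact ⟨s', hq, .step 1 _ _ _ hs le_rfl le_rfl (by simpa [step, hb] using hr)⟩
  · obtain ⟨s', hq, hr⟩ := h' hb hs K
    exact ⟨s', hq, .step 1 _ _ _ hs le_rfl le_rfl (by simpa [step, hb] using hr)⟩

/-- `N` is a variant that drops in every round; the bound counts `N` rounds of test and body, and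
the final test. -/
theorem whileDo {b : Test} (I : ℕ → Memory → Prop) {N : ℕ} (hI : I N s)
    (hstep : ∀ N s, I N s → b.holds s → Wp O S P T (fun s' => ∃ N' < N, I N' s') s)
    (hend : ∀ N s, I N s → ¬ b.holds s → Q s) :
    Wp O S (.whileDo b P) (1 + N * (1 + T)) Q s := by
  induction N using Nat.strong_induction_on generalizing s with
  | _ N ih =>
    intro hs K
    by_cases hb : b.holds s
    · obtain ⟨s', ⟨N', hN, hI'⟩, hr⟩ := hstep N s hI hb hs (.whileDo b P :: K)
      obtain ⟨s'', hq, hr'⟩ := ih N' hN hI' hr.realIn_right K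
      refine ⟨s'', hq, ?_⟩
      have hr2 : RunsTo O S (1 + (T + (1 + N' * (1 + T)))) ⟨.whileDo b P :: K, s⟩ ⟨K, s''⟩ :=
        .step 1 _ _ _ hs le_rfl le_rfl (by simpa [step, hb] using hr.trans hr')
      refine hr2.mono ?_
      have := Nat.mul_le_mul_right (1 + T) (Nat.succ_le_of_lt hN)
      rw [Nat.succ_mul] at this
      omega
    · have hr : RunsTo O S (N * (1 + T)) (step O ⟨.whileDo b P :: K, s⟩) ⟨K, s⟩ := by
        simpa [step, hb] using RunsTo.refl (O := O) _ ⟨K, s⟩ hs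
      exact ⟨s, hend N s hI hb, .step 1 _ _ _ hs le_rfl le_rfl hr⟩

end Wp

/-! ### Growth of the natural numbers in memory -/

/-- If the operand is a constant, it is at most `B`. -/
def NatOperand.BoundedBy (B : ℕ) : NatOperand → Prop
  | .const c => c ≤ B
  | .cell _ _ => True

/-- All constants among the natural-number operands used as values are at most `B`. -/
def Program.BoundedBy (B : ℕ) : Program → Prop
  | .skip => True
  | .setNat _ _ _ x y => x.BoundedBy B ∧ y.BoundedBy B
  | .setReal _ _ _ _ _ => True
  | .eval _ _ _ _ => True
  | .seq P Q => P.BoundedBy B ∧ Q.BoundedBy B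
  | .ifElse _ P Q => P.BoundedBy B ∧ Q.BoundedBy B
  | .whileDo _ P => P.BoundedBy B

theorem NatOperand.BoundedBy.value_le {B M : ℕ} {s : Memory} (hs : ∀ a i, s.nat a i ≤ M)
    (hB : B ≤ M) {x : NatOperand} (hx : x.BoundedBy B) : x.value s ≤ M := by
  cases x with
  | const c => exact le_trans hx hB
  | cell a i => exact hs _ _

/-- A stored number is a sum or truncated difference of two operands, each a constant or a cell and
thus at most `M`. -/
theorem step_nat_le {O : Evaluator} {B M : ℕ} (hB : B ≤ M) {c : Config}
    (hc : ∀ P ∈ c.todo, P.BoundedBy B) (hs : ∀ a i, c.mem.nat a i ≤ M) :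
    (∀ P ∈ (step O c).todo, P.BoundedBy B) ∧ ∀ a i, (step O c).mem.nat a i ≤ 2 * M := by
  have hs2 : ∀ a i, c.mem.nat a i ≤ 2 * M := fun a i => (hs a i).trans (by omega)
  obtain ⟨_ | ⟨P, K⟩, s⟩ := c
  · exact ⟨hc, hs2⟩
  have hK : ∀ P ∈ K, P.BoundedBy B := fun P hP => hc P (List.mem_cons_of_mem _ hP)
  have hP : P.BoundedBy B := hc P List.mem_cons_self
  cases P with
  | skip => exact ⟨hK, hs2⟩
  | setNat a i op x y =>
    refine ⟨hK, fun a' i' => ?_⟩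
    have hx : x.value s ≤ M := hP.1.value_le hs hB
    have hy : y.value s ≤ M := hP.2.value_le hs hB
    have hv : op.apply (x.value s) (y.value s) ≤ 2 * M := by
      cases op <;> simp only [NatArith.apply] <;> omega
    simp only [step, Memory.setNat]
    by_cases ha : a' = a
    · subst ha
      by_cases hi : i' = i.value s
      · subst hi
        simpa using hv
      · simpa [hi] using hs2 a' i'
    · simpa [ha] using hs2 a' i'
  | setReal a i op x y => exact ⟨hK, hs2⟩
  | eval a i x z => exact ⟨hK, hs2⟩
  | seq P Q =>
    refine ⟨?_, hs2⟩
    simp only [step, List.mem_cons, forall_eq_or_imp]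
    exact ⟨hP.1, hP.2, hK⟩
  | ifElse b P Q =>
    refine ⟨?_, hs2⟩
    simp only [step, List.mem_cons, forall_eq_or_imp]
    refine ⟨?_, hK⟩
    split_ifs
    · exact hP.1
    · exact hP.2
  | whileDo b P =>
    simp only [step]
    refine ⟨?_, hs2⟩
    split_ifs
    · simp only [List.mem_cons, forall_eq_or_imp]
      exact ⟨hP, hP, hK⟩
    · exact hK

theorem configAt_nat_le {O : Evaluator} {B : ℕ} {P : Program} {s : Memory} (hP : P.BoundedBy B)
    (hs : ∀ a i, s.nat a i ≤ B) (t a i : ℕ) : (configAt O P s t).mem.nat a i ≤ 2 ^ t * B := by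
  suffices h : (∀ P' ∈ (configAt O P s t).todo, P'.BoundedBy B) ∧
      ∀ a i, (configAt O P s t).mem.nat a i ≤ 2 ^ t * B from h.2 a i
  induction t with
  | zero => simpa [configAt] using ⟨hP, hs⟩
  | succ t ih =>
    have := step_nat_le (O := O) (Nat.le_mul_of_pos_left B (by positivity)) ih.1 ih.2
    rw [configAt, Function.iterate_succ_apply', pow_succ', mul_assoc]
    exact this

end RealRAM

/-! ### Sizes of rational numbers -/

theorem Nat.size_mul_le (a b : ℕ) : (a * b).size ≤ a.size + b.size := by
  rw [Nat.size_le, pow_add]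
  exact Nat.mul_lt_mul'' (Nat.lt_size_self a) (Nat.lt_size_self b)

theorem Nat.size_add_le (a b : ℕ) : (a + b).size ≤ a.size + b.size + 1 := by
  rw [Nat.size_le]
  have ha : a < 2 ^ (a.size + b.size) :=
    (Nat.lt_size_self a).trans_le (Nat.pow_le_pow_right two_pos (by omega))
  have hb : b < 2 ^ (a.size + b.size) :=
    (Nat.lt_size_self b).trans_le (Nat.pow_le_pow_right two_pos (by omega))
  rw [pow_succ]
  omega

theorem HasRatSizeLE.mono {x : ℝ} {b c : ℕ} (h : HasRatSizeLE x b) (hbc : b ≤ c) :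
    HasRatSizeLE x c := by
  obtain ⟨q, hq, hb⟩ := h
  exact ⟨q, hq, hb.trans hbc⟩

theorem hasRatSizeLE_zero : HasRatSizeLE 0 1 := ⟨0, by simp, by simp⟩

/-- Reduction to lowest terms does not enlarge the numerator or the denominator of the
cross-multiplied difference. Each of the two original denominators enters both of these, hence the
factor 2. -/
theorem HasRatSizeLE.sub {x y : ℝ} {b c : ℕ} (hx : HasRatSizeLE x b) (hy : HasRatSizeLE y c) :
    HasRatSizeLE (x - y) (2 * b + 2 * c + 1) := by
  obtain ⟨q, rfl, hq⟩ := hx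
  obtain ⟨r, rfl, hr⟩ := hy
  refine ⟨q - r, by push_cast; rfl, ?_⟩
  have hden : (q - r).den ≤ q.den * r.den :=
    Nat.le_of_dvd (Nat.mul_pos q.den_pos r.den_pos) (Rat.sub_den_dvd q r)
  have hnum : (q - r).num.natAbs ≤ q.num.natAbs * r.den + r.num.natAbs * q.den := by
    have h := Rat.substr_num_den' q r
    have h2 : (q - r).num.natAbs * (q.den * r.den) =
        (q.num * r.den - r.num * q.den).natAbs * (q - r).den := by
      have := congrArg Int.natAbs h
      simpa [Int.natAbs_mul, mul_assoc] using this
    have h3 : (q - r).num.natAbs * (q.den * r.den) ≤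
        (q.num * r.den - r.num * q.den).natAbs * (q.den * r.den) := by
      rw [h2]
      exact Nat.mul_le_mul_left _ hden
    have h4 := Nat.le_of_mul_le_mul_right h3 (Nat.mul_pos q.den_pos r.den_pos)
    have h5 := Int.natAbs_sub_le (q.num * r.den) (r.num * q.den)
    simp only [Int.natAbs_mul, Int.natAbs_natCast] at h5
    exact h4.trans h5
  have h1 := (Nat.size_le_size hden).trans (Nat.size_mul_le _ _)
  have h2 := (Nat.size_le_size hnum).trans (Nat.size_add_le _ _)
  have h3 := Nat.size_mul_le q.num.natAbs r.den
  have h4 := Nat.size_mul_le r.num.natAbs q.den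
  omega

/-! ### Optimality of an orientation with a compatible potential -/

/-- The increase `f (z + 1) - f z`. -/
def marginal (f : ℕ → ℝ) (z : ℕ) : ℝ := f (z + 1) - f z

theorem DiscreteConvex.monotone_marginal {f : ℕ → ℝ} (hf : DiscreteConvex f) :
    Monotone (marginal f) := by
  refine monotone_nat_of_le_succ fun z => ?_
  have := hf (z + 1) z.succ_pos
  simp only [add_tsub_cancel_right] at this
  simp only [marginal]
  linarith

/-- `c` is a subgradient of `f` at `d`, expressed by the two adjacent increments. -/
def IsSubgradientAt (f : ℕ → ℝ) (d : ℕ) (c : ℝ) : Prop :=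
  c ≤ marginal f d ∧ (0 < d → marginal f (d - 1) ≤ c)

/-- By convexity all increments from `d` upwards are at least `c` and all those below `d` are at
most `c`; they are summed away from `d` in both directions. -/
theorem IsSubgradientAt.le {f : ℕ → ℝ} (hf : DiscreteConvex f) {d : ℕ} {c : ℝ}
    (h : IsSubgradientAt f d c) (z : ℕ) : f d + c * ((z : ℝ) - d) ≤ f z := by
  have hm := hf.monotone_marginal
  rcases le_total d z with hz | hz
  · induction z, hz using Nat.le_induction with
    | base => simp
    | succ z hz ih =>
      have := h.1.trans (hm hz)
      simp only [marginal] at this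
      push_cast
      linarith
  · refine Nat.decreasingInduction' (P := fun z => f d + c * ((z : ℝ) - d) ≤ f z)
      (fun z hz _ ih => ?_) hz (by simp)
    have := (hm (Nat.le_sub_one_of_lt hz)).trans (h.2 (by omega))
    simp only [marginal] at this
    push_cast at ih
    linarith

namespace Graph.Orientation

variable {α : Type u} {β : Type v} {G : Graph α β}

theorem sum_mul_indegree [Fintype V(G)] [Fintype E(G)] (D : G.Orientation) (p : V(G) → ℝ) :
    ∑ x, p x * D.indegree x = ∑ e, p (D.head e) := by
  classical
  have h : ∀ x, p x * D.indegree x = ∑ e, if D.head e = x then p x else 0 := by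
    intro x
    rw [← Finset.sum_filter, Finset.sum_const, nsmul_eq_mul, mul_comm, indegree,
      Set.ncard_eq_toFinset_card', Set.toFinset_ofPred]
  simp_rw [h]
  rw [Finset.sum_comm]
  simp

theorem eq_or_eq (D D' : G.Orientation) (e : E(G)) :
    D.head e = D'.head e ∨ D.head e = D'.tail e := by
  rcases (D.isLink e).eq_and_eq_or_eq_and_eq (D'.isLink e) with h | h
  · exact .inl (Subtype.ext h.2)
  · exact .inr (Subtype.ext h.2)

/-- Weak duality: another orientation can only replace the head of an edge by its tail, which does
not lower the sum of the potentials of the heads. The subgradient inequalities transfer this to the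
costs. -/
theorem isOptimal_of_potential [Fintype V(G)] [Fintype E(G)] {φ : V(G) → ℕ → ℝ}
    (hφ : ∀ x, DiscreteConvex (φ x)) (D : G.Orientation) (p : V(G) → ℝ)
    (hp : ∀ x, IsSubgradientAt (φ x) (D.indegree x) (p x))
    (hD : ∀ e, p (D.head e) ≤ p (D.tail e)) : D.IsOptimal φ := by
  intro D'
  have h1 : ∑ x, p x * D.indegree x ≤ ∑ x, p x * D'.indegree x := by
    rw [sum_mul_indegree, sum_mul_indegree]
    refine Finset.sum_le_sum fun e _ => ?_
    rcases D'.eq_or_eq D e with h | h <;> rw [h]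
    exact hD e
  have h2 := Finset.sum_le_sum fun x (_ : x ∈ Finset.univ) => (hp x).le (hφ x) (D'.indegree x)
  simp only [mul_sub, Finset.sum_add_distrib, Finset.sum_sub_distrib] at h2
  simp only [cost]
  linarith

end Graph.Orientation

/-! ### Inserting an edge -/

/-- The number of indices below `k` that `h` maps to `x`. -/
def countBelow (h : ℕ → ℕ) (k x : ℕ) : ℕ := ∑ i ∈ Finset.range k, if h i = x then 1 else 0

theorem countBelow_le (h : ℕ → ℕ) (k x : ℕ) : countBelow h k x ≤ k := by
  rw [countBelow, ← Finset.card_filter]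
  exact (Finset.card_filter_le _ _).trans (Finset.card_range k).le

theorem countBelow_congr {h h' : ℕ → ℕ} {k : ℕ} (hh : ∀ i < k, h i = h' i) (x : ℕ) :
    countBelow h k x = countBelow h' k x :=
  Finset.sum_congr rfl fun i hi => by rw [hh i (Finset.mem_range.1 hi)]

theorem countBelow_succ (h : ℕ → ℕ) (k x : ℕ) :
    countBelow h (k + 1) x = countBelow h k x + if h k = x then 1 else 0 :=
  Finset.sum_range_succ _ _

/-- The old head is added on the left instead of being subtracted on the right, which avoids
truncated subtraction. -/
theorem countBelow_update {h : ℕ → ℕ} {k j : ℕ} (hj : j < k) (c x : ℕ) :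
    countBelow (Function.update h j c) k x + (if h j = x then 1 else 0) =
      countBelow h k x + if c = x then 1 else 0 := by
  have hj' := Finset.mem_range.2 hj
  rw [countBelow, countBelow, ← Finset.add_sum_erase _ _ hj',
    ← Finset.add_sum_erase (Finset.range k) _ hj', Function.update_self,
    Finset.sum_congr rfl fun i hi => by rw [Function.update_of_ne (Finset.ne_of_mem_erase hi)]]
  ring

/-- A partial orientation: the edges `j < k` with ends `u j` and `v j` are directed from `tl j` to
`hd j`. -/
def IsOriented (u v hd tl : ℕ → ℕ) (k : ℕ) : Prop :=
  ∀ j < k, (hd j = u j ∧ tl j = v j) ∨ (hd j = v j ∧ tl j = u j)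

theorem IsOriented.swap {u v hd tl : ℕ → ℕ} {k : ℕ} (h : IsOriented u v hd tl k) (j : ℕ) :
    IsOriented u v (Function.update hd j (tl j)) (Function.update tl j (hd j)) k := by
  intro i hi
  by_cases hij : i = j
  · subst hij
    simpa [and_comm, or_comm] using h i hi
  · simpa [hij] using h i hi

/-- As `c` is one end, `u k + v k - c` is the other one; the program finds the tail without a test.
-/
theorem IsOriented.succ {u v hd tl : ℕ → ℕ} {k c : ℕ} (h : IsOriented u v hd tl k)
    (hc : c = u k ∨ c = v k) :
    IsOriented u v (Function.update hd k c) (Function.update tl k (u k + v k - c)) (k + 1) := by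
  intro i hi
  by_cases hij : i = k
  · subst hij
    rcases hc with rfl | rfl <;> simp
  · simpa [hij] using h i (by omega)

/-- A partial orientation with indegrees `dg`, and a potential that certifies its optimality. -/
structure IsPartialOptimum (F : ℕ → ℕ → ℝ) (n k : ℕ) (u v hd tl dg : ℕ → ℕ) : Prop where
  oriented : IsOriented u v hd tl k
  count : ∀ x < n, dg x = countBelow hd k x
  potential : ∃ p : ℕ → ℝ, (∀ x < n, IsSubgradientAt (F x) (dg x) (p x)) ∧
    ∀ j < k, p (hd j) ≤ p (tl j)

/-- The search forest: `rk x` is zero if the vertex `x` is not marked, one if it is an end of the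
edge `k`, and else `pr x` is an edge from `x` to a vertex with smaller mark. -/
structure IsForest (n k : ℕ) (u v hd tl rk pr : ℕ → ℕ) : Prop where
  fst : rk (u k) = 1
  snd : rk (v k) = 1
  root : ∀ x < n, rk x = 1 → x = u k ∨ x = v k
  lt : ∀ x < n, 1 < rk x → pr x < k
  tail : ∀ x < n, 1 < rk x → tl (pr x) = x
  pos : ∀ x < n, 1 < rk x → 0 < rk (hd (pr x))
  decr : ∀ x < n, 1 < rk x → rk (hd (pr x)) < rk x

/-- The invariant of the reversal of a path from the vertex `t` to an end of the edge `k`: the path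
has been reversed up to the vertex `c`. The potential `q` equals `μ` along the path. -/
structure IsReversal (n k : ℕ) (u v rk pr dg : ℕ → ℕ) (t : ℕ) (q : ℕ → ℝ) (μ : ℝ) (c : ℕ)
    (hd tl : ℕ → ℕ) : Prop where
  lt : c < n
  pos : 0 < rk c
  eq : q c = μ
  oriented : IsOriented u v hd tl k
  -- Reversing the path from `t` to `c` moves one unit of indegree from `c` to `t`.
  count : ∀ x < n, countBelow hd k x + (if c = x then 1 else 0) = dg x + if t = x then 1 else 0
  le : ∀ j < k, q (hd j) ≤ q (tl j)
  -- Only parent edges of vertices with marks larger than that of `c` have been reversed, so the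
  -- forest is intact from `c` downwards.
  parent : ∀ x < n, 1 < rk x → rk x ≤ rk c →
    pr x < k ∧ tl (pr x) = x ∧ 0 < rk (hd (pr x)) ∧ rk (hd (pr x)) < rk x

section

variable {F : ℕ → ℕ → ℝ} {n k : ℕ} {u v hd tl dg rk pr : ℕ → ℕ} {t c : ℕ} {q : ℕ → ℝ} {μ : ℝ}

/-- The parent edge of `c` is tight: its head has potential at most `q c = μ`, and at least `μ`
because it is marked. Hence its reversal respects the potential. -/
theorem IsReversal.next (hu : ∀ j ≤ k, u j < n) (hv : ∀ j ≤ k, v j < n)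
    (hμ : ∀ x < n, 0 < rk x → μ ≤ q x) (h : IsReversal n k u v rk pr dg t q μ c hd tl)
    (hc : 1 < rk c) :
    IsReversal n k u v rk pr dg t q μ (hd (pr c)) (Function.update hd (pr c) c)
      (Function.update tl (pr c) (hd (pr c))) ∧ rk (hd (pr c)) < rk c := by
  obtain ⟨hj, ht, hp, hl⟩ := h.parent c h.lt hc le_rfl
  have hlt : hd (pr c) < n := by
    rcases h.oriented _ hj with h' | h' <;> rw [h'.1]
    exacts [hu _ hj.le, hv _ hj.le]
  have hq : q (hd (pr c)) = μ := by
    have := h.le _ hj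
    rw [ht, h.eq] at this
    exact this.antisymm (hμ _ hlt hp)
  refine ⟨⟨hlt, hp, hq, ?_, fun x hx => ?_, fun j hj' => ?_, fun x hx h1 h2 => ?_⟩, hl⟩
  · have := h.oriented.swap (pr c)
    rwa [ht] at this
  · rw [countBelow_update hj, h.count x hx]
  · by_cases hjc : j = pr c
    · subst hjc
      simp [hq, h.eq]
    · simpa [hjc] using h.le j hj'
  · have hx' := h.parent x hx h1 (h2.trans hl.le)
    -- A common parent edge would have both `x` and `c` as tail, but the mark of `x` is smaller than
    -- that of `c`.
    have hne : pr x ≠ pr c := by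
      intro he
      have h3 := hx'.2.1
      rw [he, ht] at h3
      subst h3
      omega
    simpa [hne] using hx'

/-- `q` raises `p` to at least `μ` on the marked set. By `hmin` the upper subgradient bounds
survive; by `hcl` no edge has a raised head and an unraised tail. At `t` the value is exactly `μ`,
as `p t` was at most `μ`. -/
theorem IsPartialOptimum.exists_isReversal
    (h : IsPartialOptimum F n k u v hd tl dg) (hf : IsForest n k u v hd tl rk pr)
    (hcl : ∀ j < k, 0 < rk (hd j) → 0 < rk (tl j)) (ht : t < n) (htm : 0 < rk t)
    (hmin : ∀ x < n, 0 < rk x → marginal (F t) (dg t) ≤ marginal (F x) (dg x)) :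
    ∃ q, (∀ x < n, 0 < rk x → marginal (F t) (dg t) ≤ q x) ∧
      (∀ x < n, IsSubgradientAt (F x) (dg x) (q x)) ∧
      IsReversal n k u v rk pr dg t q (marginal (F t) (dg t)) t hd tl := by
  obtain ⟨p, hp, hle⟩ := h.potential
  refine ⟨fun x => if 0 < rk x then max (p x) (marginal (F t) (dg t)) else p x, fun x _ h0 => ?_,
    fun x hx => ?_, ht, htm, ?_, h.oriented, fun x hx => by rw [h.count x hx], fun j hj => ?_,
    fun x hx h1 _ => ⟨hf.lt x hx h1, hf.tail x hx h1, hf.pos x hx h1, hf.decr x hx h1⟩⟩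
  · simp [h0]
  · dsimp only
    split_ifs with h0
    · exact ⟨max_le (hp x hx).1 (hmin x hx h0), fun hd => ((hp x hx).2 hd).trans (le_max_left _ _)⟩
    · exact hp x hx
  · simpa [htm] using (hp t ht).1
  · split_ifs with h1 h2 h2
    · exact max_le_max_right _ (hle j hj)
    · exact absurd (hcl j hj h1) h2
    · exact (hle j hj).trans (le_max_left _ _)
    · exact hle j hj

/-- The new edge gives `c` back the lost unit of indegree, and its tail is marked, so has potential
at least `μ = q c`. At `t`, `μ` becomes the last increment below the new indegree, and by convexity
it is at most the next one. -/
theorem IsReversal.isPartialOptimum (hF : ∀ x, Monotone (marginal (F x)))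
    (hu : u k < n) (hv : v k < n)
    (hμ : ∀ x < n, 0 < rk x → marginal (F t) (dg t) ≤ q x)
    (hq : ∀ x < n, IsSubgradientAt (F x) (dg x) (q x)) (hqt : q t = marginal (F t) (dg t))
    (h : IsReversal n k u v rk pr dg t q (marginal (F t) (dg t)) c hd tl)
    (hfst : rk (u k) = 1) (hsnd : rk (v k) = 1) (hc : c = u k ∨ c = v k) :
    IsPartialOptimum F n (k + 1) u v (Function.update hd k c)
      (Function.update tl k (u k + v k - c)) (Function.update dg t (dg t + 1)) := by
  refine ⟨h.oriented.succ hc, fun x hx => ?_, q, fun x hx => ?_, fun j hj => ?_⟩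
  · rw [countBelow_succ, Function.update_self,
      countBelow_congr (h' := hd) fun i hi => Function.update_of_ne hi.ne _ _, h.count x hx]
    by_cases hxt : x = t
    · subst hxt
      simp
    · simp [hxt, Ne.symm hxt]
  · by_cases hxt : x = t
    · subst hxt
      rw [Function.update_self, hqt]
      exact ⟨hF x (Nat.le_succ _), fun _ => le_rfl⟩
    · rw [Function.update_of_ne hxt]
      exact hq x hx
  · by_cases hjk : j = k
    · subst hjk
      simp only [Function.update_self, h.eq]
      rcases hc with rfl | rfl
      · rw [Nat.add_sub_cancel_left]
        exact hμ _ hv (by omega)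
      · rw [Nat.add_sub_cancel]
        exact hμ _ hu (by omega)
    · simpa [hjk] using h.le j (by omega)

end

/-! ### The program -/

namespace RealRAM

-- Layout of the natural memory: array 0 holds `n`, `m`, the current edge `k`, a loop counter, the
-- selected vertex `t`, the path vertex `c` and a scratch cell, in cells 0 to 6. Arrays 1 to 7 hold
-- the two ends, heads, tails, marks, parent edges and indegrees.
namespace InsertionProgram

/-- Cell `i` of the array `0`. -/
abbrev var (i : ℕ) : NatOperand := .cell 0 (.const i)

/-- Copy the value of `x` to cell `i` of the array `a`. -/
abbrev copy (a : ℕ) (i x : NatOperand) : Program := .setNat a i .add x (.const 0)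

/-- Add one to cell `i` of the array `a`. -/
abbrev incr (a : ℕ) (i : NatOperand) : Program := .setNat a i .add (.cell a i) (.const 1)

/-- Store the marginal cost of the vertex `x` in cell `i` of the real array `1`. -/
def evalMarginal (i : ℕ) (x : NatOperand) : Program :=
  .seq (.setNat 0 (.const 6) .add (.cell 7 x) (.const 1)) <|
  .seq (.eval 0 (.const 0) x (var 6)) <|
  .seq (.eval 0 (.const 1) x (.cell 7 x)) <|
  .setReal 1 (.const i) .sub (.cell 0 (.const 0)) (.cell 0 (.const 1))

/-- Remove all marks. -/
def clear : Program :=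
  .seq (copy 0 (.const 3) (.const 0)) <|
  .whileDo (.natLT (var 3) (var 0)) <|
    .seq (copy 5 (var 3) (.const 0)) (incr 0 (.const 3))

/-- Mark the ends of the current edge. -/
def markEnds : Program :=
  .seq (copy 5 (.cell 1 (var 2)) (.const 1)) (copy 5 (.cell 2 (var 2)) (.const 1))

/-- Mark the tail of the edge in cell `3` and start again with the edge `0`. -/
def extend : Program :=
  .seq (copy 6 (.cell 4 (var 3)) (var 3)) <|
  .seq (.setNat 5 (.cell 4 (var 3)) .add (.cell 5 (.cell 3 (var 3))) (.const 1)) <|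
  copy 0 (.const 3) (.const 0)

/-- Mark all vertices from which a marked vertex can be reached. -/
def search : Program :=
  .seq (copy 0 (.const 3) (.const 0)) <|
  .whileDo (.natLT (var 3) (var 2)) <|
    .ifElse (.natLT (.const 0) (.cell 5 (.cell 4 (var 3)))) (incr 0 (.const 3)) <|
    .ifElse (.natLT (.const 0) (.cell 5 (.cell 3 (var 3)))) extend (incr 0 (.const 3))

/-- Select a marked vertex with the smallest marginal cost. -/
def select : Program :=
  .seq (copy 0 (.const 4) (.cell 1 (var 2))) <|
  .seq (copy 0 (.const 3) (.const 0)) <|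
  .whileDo (.natLT (var 3) (var 0)) <|
    .seq (.ifElse (.natLT (.const 0) (.cell 5 (var 3)))
      (.seq (evalMarginal 0 (var 3)) <|
       .seq (evalMarginal 1 (var 4)) <|
       .ifElse (.realLE (.cell 1 (.const 0)) (.cell 1 (.const 1))) (copy 0 (.const 4) (var 3)) .skip)
      .skip) <|
    incr 0 (.const 3)

/-- Reverse the path from the selected vertex to an end of the current edge. -/
def reverse : Program :=
  .seq (copy 0 (.const 5) (var 4)) <|
  .whileDo (.natLT (.const 1) (.cell 5 (var 5))) <|
    .seq (copy 0 (.const 3) (.cell 6 (var 5))) <|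
    .seq (copy 4 (var 3) (.cell 3 (var 3))) <|
    .seq (copy 3 (var 3) (var 5)) <|
    copy 0 (.const 5) (.cell 4 (var 3))

/-- Direct the current edge to the vertex in cell `5`. -/
def insert : Program :=
  .seq (incr 7 (var 4)) <|
  .seq (copy 3 (var 2) (var 5)) <|
  .seq (.setNat 0 (.const 6) .add (.cell 1 (var 2)) (.cell 2 (var 2))) <|
  .seq (.setNat 4 (var 2) .sub (var 6) (var 5)) <|
  incr 0 (.const 2)

end InsertionProgram

open InsertionProgram in
/-- The edges are inserted one after the other. Each time the indegree of one vertex grows by one: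
of a vertex with smallest marginal cost among those from which the new edge can be reached. -/
def insertionProgram : Program :=
  .whileDo (.natLT (var 2) (var 1)) <|
    .seq clear <| .seq markEnds <| .seq search <| .seq select <| .seq reverse insert

/-! ### Correctness and running time of the phases of one insertion. -/

namespace InsertionProgram

/-- The contents of the memory, apart from the auxiliary cells. -/
structure Data where
  (n m k : ℕ)
  (u v hd tl rk pr dg : ℕ → ℕ)

/-- The memory `s` has the contents `σ`. -/
structure Data.Agrees (σ : Data) (s : Memory) : Prop where
  n : s.nat 0 0 = σ.n
  m : s.nat 0 1 = σ.m
  k : s.nat 0 2 = σ.k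
  u : s.nat 1 = σ.u
  v : s.nat 2 = σ.v
  hd : s.nat 3 = σ.hd
  tl : s.nat 4 = σ.tl
  rk : s.nat 5 = σ.rk
  pr : s.nat 6 = σ.pr
  dg : s.nat 7 = σ.dg

theorem Data.Agrees.eqs {σ : Data} {s : Memory} (h : σ.Agrees s) :
    s.nat 0 0 = σ.n ∧ s.nat 0 1 = σ.m ∧ s.nat 0 2 = σ.k ∧ s.nat 1 = σ.u ∧ s.nat 2 = σ.v ∧
      s.nat 3 = σ.hd ∧ s.nat 4 = σ.tl ∧ s.nat 5 = σ.rk ∧ s.nat 6 = σ.pr ∧ s.nat 7 = σ.dg :=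
  ⟨h.n, h.m, h.k, h.u, h.v, h.hd, h.tl, h.rk, h.pr, h.dg⟩

variable {O : Evaluator} {S : Set ℝ} {σ : Data} {s : Memory}

section

attribute [local simp] Memory.setNat Memory.setReal NatOperand.value RealOperand.value
  NatArith.apply RealArith.apply Test.holds Data.Agrees.eqs

theorem wp_clear (h : σ.Agrees s) :
    Wp O S clear (3 + σ.n * 4)
      (fun s' => ∃ rk, {σ with rk := rk}.Agrees s' ∧ ∀ x < σ.n, rk x = 0) s := by
  refine (Wp.seq (Wp.setNat (Wp.whileDo (N := σ.n) (T := 3) (fun N s =>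
    ∃ rk, {σ with rk := rk}.Agrees s ∧ s.nat 0 3 + N = σ.n ∧ ∀ x < s.nat 0 3, rk x = 0)
    ⟨σ.rk, ?_, ?_, ?_⟩ ?_ ?_))).mono (by omega) fun _ h => h
  · constructor <;> simp [h.eqs]
  · simp
  · simp
  · rintro N s ⟨rk, h, hN, hz⟩ hb
    simp [h.eqs] at hb
    refine Wp.seq (Wp.setNat (Wp.setNat ⟨N - 1, by omega, Function.update rk (s.nat 0 3) 0, ?_, ?_,
      fun x hx => ?_⟩))
    · constructor <;> simp [h.eqs]
    · simp
      omega
    · simp at hx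
      by_cases hx' : x = s.nat 0 3
      · simp [hx']
      · simpa [hx'] using hz x (by omega)
  · rintro N s ⟨rk, h, hN, hz⟩ hb
    simp [h.eqs] at hb
    exact ⟨rk, h, fun x hx => hz x (hx.trans_le hb)⟩

theorem wp_markEnds (h : σ.Agrees s) (h0 : ∀ x < σ.n, σ.rk x = 0) :
    Wp O S markEnds 3 (fun s' => ∃ rk, {σ with rk := rk}.Agrees s' ∧
      ∀ x, x < σ.n ∨ x = σ.u σ.k ∨ x = σ.v σ.k →
        rk x = if x = σ.u σ.k ∨ x = σ.v σ.k then 1 else 0) s := by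
  refine Wp.seq (Wp.setNat (Wp.setNat
    ⟨Function.update (Function.update σ.rk (σ.u σ.k) 1) (σ.v σ.k) 1, ?_, fun x hx => ?_⟩))
  · constructor <;> simp [h.eqs]
  · simp only [Function.update_apply]
    split_ifs <;> grind

/-- The number of vertices without mark. -/
def unmarked (n : ℕ) (rk : ℕ → ℕ) : ℕ := ((Finset.range n).filter fun x => rk x = 0).card

theorem unmarked_update {n : ℕ} {rk : ℕ → ℕ} {x c : ℕ} (hx : x < n) (h : rk x = 0) (hc : 0 < c) :
    unmarked n (Function.update rk x c) < unmarked n rk := by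
  refine Finset.card_lt_card ⟨fun y hy => ?_, fun hs => ?_⟩
  · simp only [Finset.mem_filter, Function.update_apply] at hy ⊢
    split_ifs at hy with hxy
    · omega
    · exact hy
  · have hm : x ∈ (Finset.range n).filter fun x => rk x = 0 := by simp [hx, h]
    have := hs hm
    simp at this
    omega

theorem unmarked_le (n : ℕ) (rk : ℕ → ℕ) : unmarked n rk ≤ n :=
  (Finset.card_filter_le _ _).trans (Finset.card_range n).le

/-- The invariant of the search. -/
structure SearchInv (σ : Data) (rk pr : ℕ → ℕ) : Prop where
  forest : IsForest σ.n σ.k σ.u σ.v σ.hd σ.tl rk pr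
  -- A new mark exceeds an existing one by one and uses up an unmarked vertex. Thus marks are at
  -- most `n + 1`, which bounds the length of the reversed path.
  le : ∀ x < σ.n, 0 < rk x → rk x + unmarked σ.n rk ≤ σ.n + 1

/-- Existing parent edges have marked heads, so their heads differ from the newly marked vertex and
keep their marks. -/
theorem SearchInv.extend {rk pr : ℕ → ℕ} (h : SearchInv σ rk pr) {j : ℕ} (hj : j < σ.k)
    (hhd : σ.hd j < σ.n) (htl : σ.tl j < σ.n) (h0 : rk (σ.tl j) = 0) (h1 : 0 < rk (σ.hd j)) :
    SearchInv σ (Function.update rk (σ.tl j) (rk (σ.hd j) + 1)) (Function.update pr (σ.tl j) j) := by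
  have hne : σ.hd j ≠ σ.tl j := fun he => by rw [he] at h1; omega
  have hlt := unmarked_update (c := rk (σ.hd j) + 1) htl h0 (Nat.succ_pos _)
  have hle := h.le _ hhd h1
  have hfst := h.forest.fst
  have hsnd := h.forest.snd
  refine ⟨⟨?_, ?_, fun x hx h' => ?_, fun x hx h' => ?_, fun x hx h' => ?_, fun x hx h' => ?_,
    fun x hx h' => ?_⟩, fun x hx h' => ?_⟩
  · rwa [Function.update_of_ne]
    grind
  · rwa [Function.update_of_ne]
    grind
  all_goals by_cases hxt : x = σ.tl j
  · subst hxt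
    simp at h'
    omega
  · exact h.forest.root x hx (by simpa [hxt] using h')
  · simpa [hxt] using hj
  · simp only [Function.update_of_ne hxt] at h' ⊢
    exact h.forest.lt x hx h'
  · simp [hxt]
  · simp only [Function.update_of_ne hxt] at h' ⊢
    exact h.forest.tail x hx h'
  · simpa [hxt, hne] using h1
  · simp only [Function.update_of_ne hxt] at h' ⊢
    have := h.forest.pos x hx h'
    rwa [Function.update_of_ne]
    grind
  · simp [hxt, hne]
  · simp only [Function.update_of_ne hxt] at h' ⊢
    have := h.forest.decr x hx h'
    have := h.forest.pos x hx h'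
    rwa [Function.update_of_ne]
    grind
  · subst hxt
    rw [Function.update_self]
    omega
  · simp only [Function.update_of_ne hxt] at h' ⊢
    have := h.le x hx h'
    omega

/-- No mark exceeds one, so the conditions on `pr` are vacuous and entries left by earlier searches
do no harm. -/
theorem searchInv_of_ends {rk : ℕ → ℕ}
    (h : ∀ x, x < σ.n ∨ x = σ.u σ.k ∨ x = σ.v σ.k →
        rk x = if x = σ.u σ.k ∨ x = σ.v σ.k then 1 else 0) : SearchInv σ rk σ.pr := by
  have hle : ∀ x < σ.n, rk x ≤ 1 := fun x hx => by
    rw [h x (.inl hx)]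
    split_ifs <;> omega
  refine ⟨⟨by simpa using h (σ.u σ.k), by simpa using h (σ.v σ.k), fun x hx h1 => ?_,
    fun x hx h1 => ?_, fun x hx h1 => ?_, fun x hx h1 => ?_, fun x hx h1 => ?_⟩, fun x hx h1 => ?_⟩
  · by_contra hne
    rw [h x (.inl hx), if_neg hne] at h1
    omega
  all_goals have := hle x hx
  all_goals first | omega | skip
  have := unmarked_le σ.n rk
  omega

/-- On exit all edges have been scanned since the last new mark, so the marked set is closed under
passing from head to tail. -/
theorem wp_search (h : σ.Agrees s) (hi : SearchInv σ σ.rk σ.pr)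
    (hhd : ∀ j < σ.k, σ.hd j < σ.n) (htl : ∀ j < σ.k, σ.tl j < σ.n) :
    Wp O S search (3 + (σ.n * (σ.k + 1) + σ.k) * 8)
      (fun s' => ∃ rk pr, {σ with rk := rk, pr := pr}.Agrees s' ∧ SearchInv σ rk pr ∧
        ∀ j < σ.k, 0 < rk (σ.hd j) → 0 < rk (σ.tl j)) s := by
  -- The variant is lexicographic: a restart of the scan costs an unmarked vertex, worth `k + 1`,
  -- and otherwise the remaining part of the scan shrinks.
  refine (Wp.seq (Wp.setNat (Wp.whileDo (N := unmarked σ.n σ.rk * (σ.k + 1) + σ.k) (T := 7)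
    (fun N s => ∃ rk pr, {σ with rk := rk, pr := pr}.Agrees s ∧
      unmarked σ.n rk * (σ.k + 1) + (σ.k - s.nat 0 3) = N ∧ SearchInv σ rk pr ∧
      ∀ j < s.nat 0 3, 0 < rk (σ.hd j) → 0 < rk (σ.tl j))
    ⟨σ.rk, σ.pr, ?_, ?_, hi, ?_⟩ ?_ ?_))).mono ?_ fun _ h => h
  · constructor <;> simp [h.eqs]
  · simp
  · simp
  · rintro N s ⟨rk, pr, h, rfl, hi, hc⟩ hb
    simp [h.eqs] at hb
    have hnext : (0 < rk (σ.hd (s.nat 0 3)) → 0 < rk (σ.tl (s.nat 0 3))) →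
        Wp O S (incr 0 (.const 3)) 1 (fun s' =>
          ∃ N' < unmarked σ.n rk * (σ.k + 1) + (σ.k - s.nat 0 3),
          ∃ rk pr, {σ with rk := rk, pr := pr}.Agrees s' ∧
      unmarked σ.n rk * (σ.k + 1) + (σ.k - s'.nat 0 3) = N' ∧ SearchInv σ rk pr ∧
      ∀ j < s'.nat 0 3, 0 < rk (σ.hd j) → 0 < rk (σ.tl j)) s := by
      intro hj
      refine Wp.setNat ⟨_, ?_, rk, pr, ?_, rfl, hi, fun j hj' => ?_⟩
      · simp
        omega
      · constructor <;> simp [h.eqs]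
      · simp at hj'
        rcases Nat.le_iff_lt_or_eq.1 hj' with hj' | rfl
        · exact hc j hj'
        · exact hj
    refine Wp.ifElse (T := 6) (fun hb1 => ?_) fun hb1 => Wp.ifElse (T := 5) (fun hb2 => ?_)
      fun hb2 => ?_
    · simp [h.eqs] at hb1
      exact (hnext fun _ => hb1).mono (by omega) fun _ h => h
    · simp [h.eqs] at hb1 hb2
      have hlt := unmarked_update (c := rk (σ.hd (s.nat 0 3)) + 1) (htl _ hb) hb1 (Nat.succ_pos _)
      refine Wp.seq (Wp.setNat (Wp.seq (Wp.setNat (Wp.setNat ⟨_, ?_,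
        Function.update rk (σ.tl (s.nat 0 3)) (rk (σ.hd (s.nat 0 3)) + 1),
        Function.update pr (σ.tl (s.nat 0 3)) (s.nat 0 3), ?_, rfl,
        hi.extend hb (hhd _ hb) (htl _ hb) hb1 hb2, fun j hj => ?_⟩))))
      · simp
        have := Nat.mul_le_mul_right (σ.k + 1) (Nat.succ_le_of_lt hlt)
        rw [Nat.succ_mul] at this
        omega
      · constructor <;> simp [h.eqs]
      · simp at hj
    · simp [h.eqs] at hb1 hb2
      exact (hnext fun h => by omega).mono (by omega) fun _ h => h
  · rintro N s ⟨rk, pr, h, -, hi, hc⟩ hb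
    simp [h.eqs] at hb
    exact ⟨rk, pr, h, hi, fun j hj => hc j (by omega)⟩
  · have := Nat.mul_le_mul_right (σ.k + 1) (unmarked_le σ.n σ.rk)
    omega

/-- The real numbers computed from the data lie in `S`, and the evaluation time is at most `E`. -/
structure Admissible (O : Evaluator) (S : Set ℝ) (n m E : ℕ) : Prop where
  value_mem : ∀ x < n, ∀ z ≤ m, O.value x z ∈ S
  -- Before an insertion every indegree is at most `k < m`, so only these marginals occur, with
  -- evaluations at arguments up to `m`.
  marginal_mem : ∀ x < n, ∀ z < m, marginal (O.value x) z ∈ S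
  time_le : ∀ x < n, ∀ z ≤ m, O.time x z ≤ E

theorem wp_evalMarginal {E : ℕ} (hO : Admissible O S σ.n σ.m E) (h : σ.Agrees s) (c : ℕ) {i : ℕ}
    -- Cell 6 is overwritten by the increased indegree before the vertex number is read again.
    (hi : i ≠ 6) (hx : s.nat 0 i < σ.n) (hd : σ.dg (s.nat 0 i) < σ.m) :
    Wp O S (evalMarginal c (var i)) (7 + 2 * E) (fun s' => σ.Agrees s' ∧
      s'.real 1 = Function.update (s.real 1) c
        (marginal (O.value (s.nat 0 i)) (σ.dg (s.nat 0 i))) ∧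
      ∀ j ≠ 6, s'.nat 0 j = s.nat 0 j) s := by
  refine (Wp.seq (Wp.setNat (Wp.seq (Wp.eval (E := E) ?_ ?_ (Wp.seq (Wp.eval (E := E) ?_ ?_
    (Wp.setReal ?_ ⟨?_, ?_, fun j hj => ?_⟩))))))).mono (by omega) fun _ h => h
  · simpa [h.eqs, hi] using hO.value_mem _ hx _ hd
  · simpa [h.eqs, hi] using hO.time_le _ hx _ hd
  · simpa [h.eqs, hi] using hO.value_mem _ hx _ hd.le
  · simpa [h.eqs, hi] using hO.time_le _ hx _ hd.le
  · simpa [h.eqs, hi, marginal] using hO.marginal_mem _ hx _ hd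
  · constructor <;> simp [h.eqs]
  · simp [h.eqs, hi, marginal]
  · simp [hj]

theorem wp_select {E : ℕ} (hO : Admissible O S σ.n σ.m E) (h : σ.Agrees s)
    (hu : σ.u σ.k < σ.n) (hrk : 0 < σ.rk (σ.u σ.k)) (hdg : ∀ x < σ.n, σ.dg x < σ.m) :
    Wp O S select (5 + σ.n * (1 + (22 + 4 * E))) (fun s' => σ.Agrees s' ∧ s'.nat 0 4 < σ.n ∧
      0 < σ.rk (s'.nat 0 4) ∧ ∀ x < σ.n, 0 < σ.rk x →
        marginal (O.value (s'.nat 0 4)) (σ.dg (s'.nat 0 4)) ≤ marginal (O.value x) (σ.dg x)) s := by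
  -- Cell 4 is a best marked vertex among those scanned, starting with an end of the new edge. Each
  -- comparison recomputes both marginals, hence four evaluations.
  refine (Wp.seq (Wp.setNat (Wp.seq (Wp.setNat (Wp.whileDo (N := σ.n) (T := 22 + 4 * E) (fun N s =>
    σ.Agrees s ∧ s.nat 0 3 + N = σ.n ∧ s.nat 0 4 < σ.n ∧ 0 < σ.rk (s.nat 0 4) ∧
      ∀ x < s.nat 0 3, 0 < σ.rk x →
        marginal (O.value (s.nat 0 4)) (σ.dg (s.nat 0 4)) ≤ marginal (O.value x) (σ.dg x))
    ⟨?_, ?_, ?_, ?_, ?_⟩ ?_ ?_))))).mono (by omega) fun _ h => h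
  · constructor <;> simp [h.eqs]
  · simp
  · simpa [h.eqs] using hu
  · simpa [h.eqs] using hrk
  · simp
  · rintro N s ⟨h, hN, ht, htr, hm⟩ hb
    simp [h.eqs] at hb
    refine Wp.mono (Wp.seq (T' := 1) (Wp.ifElse (T := 19 + 4 * E) (fun h1 => ?_) fun h1 => ?_))
      (by omega) fun _ h => h
    · simp [h.eqs] at h1
      refine (Wp.seq ((wp_evalMarginal hO h 0 (by decide) hb (hdg _ hb)).mono le_rfl ?_)).mono
        (T := 1 + (7 + 2 * E + (1 + (7 + 2 * E + 2)))) (by omega) fun _ h => h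
      rintro s1 ⟨hs1, hr1, hn1⟩
      have h3 := hn1 3 (by decide)
      have h4 := hn1 4 (by decide)
      rw [← h4] at ht
      refine Wp.seq ((wp_evalMarginal hO hs1 1 (by decide) ht (hdg _ ht)).mono le_rfl ?_)
      rintro s2 ⟨hs2, hr2, hn2⟩
      rw [h4] at ht hr2
      have h3' := (hn2 3 (by decide)).trans h3
      have h4' := (hn2 4 (by decide)).trans h4
      refine Wp.ifElse (fun hle => Wp.setNat (Wp.setNat ⟨N - 1, by omega, ?_, ?_, ?_, ?_, ?_⟩))
        fun hle => Wp.skip (Wp.setNat ⟨N - 1, by omega, ?_, ?_, ?_, ?_, ?_⟩)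
      · constructor <;> simp [hs2.eqs]
      · simp [h3']
        omega
      · simpa [h3'] using hb
      · simpa [h3'] using h1
      · simp [hr2, hr1] at hle
        intro x hx hxr
        simp [h3'] at hx ⊢
        rcases Nat.le_iff_lt_or_eq.1 hx with hx | rfl
        · exact hle.trans (hm x hx hxr)
        · exact le_rfl
      · constructor <;> simp [hs2.eqs]
      · simp [h3']
        omega
      · simpa [h4'] using ht
      · simpa [h4'] using htr
      · simp [hr2, hr1] at hle
        intro x hx hxr
        simp [h3', h4'] at hx ⊢
        rcases Nat.le_iff_lt_or_eq.1 hx with hx | rfl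
        · exact hm x hx hxr
        · exact hle.le
    · simp [h.eqs] at h1
      refine (Wp.skip (Wp.setNat ⟨N - 1, by omega, ?_, ?_, ?_, ?_, ?_⟩)).mono (by omega) fun _ h => h
      · constructor <;> simp [h.eqs]
      · simp
        omega
      · simpa using ht
      · simpa using htr
      · intro x hx hxr
        simp at hx ⊢
        rcases Nat.le_iff_lt_or_eq.1 hx with hx | rfl
        · exact hm x hx hxr
        · omega
  · rintro N s ⟨h, hN, ht, htr, hm⟩ hb
    simp [h.eqs] at hb
    exact ⟨h, ht, htr, fun x hx => hm x (by omega)⟩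

/-- The mark of the path vertex is the variant. It stays positive, so the loop stops at mark one. -/
theorem wp_reverse {t : ℕ} {q : ℕ → ℝ} {μ : ℝ} (h : σ.Agrees s) (ht : s.nat 0 4 = t)
    (hu : ∀ j ≤ σ.k, σ.u j < σ.n) (hv : ∀ j ≤ σ.k, σ.v j < σ.n)
    (hμ : ∀ x < σ.n, 0 < σ.rk x → μ ≤ q x)
    (hr : IsReversal σ.n σ.k σ.u σ.v σ.rk σ.pr σ.dg t q μ t σ.hd σ.tl) :
    Wp O S reverse (3 + σ.rk t * 8) (fun s' => ∃ hd tl, {σ with hd := hd, tl := tl}.Agrees s' ∧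
      s'.nat 0 4 = t ∧ σ.rk (s'.nat 0 5) = 1 ∧
      IsReversal σ.n σ.k σ.u σ.v σ.rk σ.pr σ.dg t q μ (s'.nat 0 5) hd tl) s := by
  refine (Wp.seq (Wp.setNat (Wp.whileDo (N := σ.rk t) (T := 7) (fun N s =>
    ∃ hd tl, {σ with hd := hd, tl := tl}.Agrees s ∧
      s.nat 0 4 = t ∧ σ.rk (s.nat 0 5) = N ∧
      IsReversal σ.n σ.k σ.u σ.v σ.rk σ.pr σ.dg t q μ (s.nat 0 5) hd tl)
    ⟨σ.hd, σ.tl, ?_, ?_, ?_, ?_⟩ ?_ ?_))).mono (by omega) fun _ h => h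
  · constructor <;> simp [h.eqs]
  · simpa using ht
  · simp [ht]
  · simpa [ht] using hr
  · rintro N s ⟨hd, tl, h, ht, rfl, hr⟩ hb
    simp [h.eqs] at hb
    obtain ⟨hr', hlt⟩ := hr.next hu hv hμ hb
    refine Wp.seq (Wp.setNat (Wp.seq (Wp.setNat (Wp.seq (Wp.setNat (Wp.setNat
      ⟨_, ?_, Function.update hd (σ.pr (s.nat 0 5)) (s.nat 0 5),
      Function.update tl (σ.pr (s.nat 0 5)) (hd (σ.pr (s.nat 0 5))), ?_, ?_, rfl, ?_⟩))))))
    · simpa [h.eqs] using hlt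
    · constructor <;> simp [h.eqs]
    · simpa using ht
    · simpa [h.eqs] using hr'
  · rintro N s ⟨hd, tl, h, ht, rfl, hr⟩ hb
    simp [h.eqs] at hb
    exact ⟨hd, tl, h, ht, by have := hr.pos; omega, hr⟩

theorem wp_insert (h : σ.Agrees s) :
    Wp O S insert 9 (fun s' => Data.Agrees {σ with
      hd := Function.update σ.hd σ.k (s.nat 0 5)
      tl := Function.update σ.tl σ.k (σ.u σ.k + σ.v σ.k - s.nat 0 5)
      dg := Function.update σ.dg (s.nat 0 4) (σ.dg (s.nat 0 4) + 1)
      k := σ.k + 1} s') s := by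
  refine Wp.seq (Wp.setNat (Wp.seq (Wp.setNat (Wp.seq (Wp.setNat (Wp.seq (Wp.setNat
    (Wp.setNat ?_))))))))
  constructor <;> simp [h.eqs]

end

end InsertionProgram
end RealRAM

/-! ### The main loop. -/

namespace RealRAM

namespace InsertionProgram

variable {O : Evaluator} {S : Set ℝ} {σ : Data} {s : Memory} {E : ℕ}

theorem _root_.IsOriented.lt {u v hd tl : ℕ → ℕ} {n k : ℕ} (h : IsOriented u v hd tl k)
    (hu : ∀ j < k, u j < n) (hv : ∀ j < k, v j < n) {j : ℕ} (hj : j < k) :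
    hd j < n ∧ tl j < n := by
  rcases h j hj with h | h <;> rw [h.1, h.2]
  exacts [⟨hu j hj, hv j hj⟩, ⟨hv j hj, hu j hj⟩]

/-- The left side is the total charge of the phases, with `r` bounding the mark of the selected
vertex; 100 is a generous constant. -/
theorem time_insert_edge_le {n m k E r : ℕ} (hk : k < m) (hr : r ≤ n + 1) :
    1 + (3 + n * 4 + (1 + (3 + (1 + (3 + (n * (k + 1) + k) * 8 +
      (1 + (5 + n * (1 + (22 + 4 * E)) + (1 + (3 + r * 8 + 9))))))))) ≤
      100 * (n + m + 1) ^ 2 * (E + 1) := by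
  have h1 : n * (k + 1) ≤ n * m := Nat.mul_le_mul_left n hk
  have h2 : 0 ≤ n * m * E := Nat.zero_le _
  nlinarith [Nat.zero_le (n * n), Nat.zero_le (m * m), Nat.zero_le (n * n * E),
    Nat.zero_le (m * m * E), Nat.zero_le (m * E), Nat.zero_le (n * E), Nat.zero_le (n * m)]

/-- One iteration of the main loop inserts one edge. -/
theorem wp_insert_edge (hO : Admissible O S σ.n σ.m E)
    (hF : ∀ x, Monotone (marginal (O.value x)))
    (hu : ∀ j < σ.m, σ.u j < σ.n) (hv : ∀ j < σ.m, σ.v j < σ.n) (h : σ.Agrees s)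
    (hk : σ.k < σ.m) (hopt : IsPartialOptimum O.value σ.n σ.k σ.u σ.v σ.hd σ.tl σ.dg) :
    Wp O S (.seq clear <| .seq markEnds <| .seq search <| .seq select <| .seq reverse insert)
      (100 * (σ.n + σ.m + 1) ^ 2 * (E + 1))
      (fun s' => ∃ hd tl rk pr dg, Data.Agrees
          {σ with k := σ.k + 1, hd := hd, tl := tl, rk := rk, pr := pr, dg := dg} s' ∧
        IsPartialOptimum O.value σ.n (σ.k + 1) σ.u σ.v hd tl dg) s := by
  have huk := hu _ hk
  have hvk := hv _ hk
  have hu' : ∀ j ≤ σ.k, σ.u j < σ.n := fun j hj => hu j (hj.trans_lt hk)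
  have hv' : ∀ j ≤ σ.k, σ.v j < σ.n := fun j hj => hv j (hj.trans_lt hk)
  have hlt : ∀ j < σ.k, σ.hd j < σ.n ∧ σ.tl j < σ.n := fun j hj =>
    hopt.oriented.lt (fun j hj => hu' j hj.le) (fun j hj => hv' j hj.le) hj
  refine Wp.mono (Wp.seq ((wp_clear h).mono le_rfl ?_)) (time_insert_edge_le (r := σ.n + 1) hk le_rfl)
    fun _ h => h
  rintro s1 ⟨rk1, h1, hrk1⟩
  refine Wp.seq ((wp_markEnds h1 hrk1).mono le_rfl ?_)
  rintro s2 ⟨rk2, h2, hrk2⟩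
  refine Wp.seq ((wp_search h2 (searchInv_of_ends hrk2) (fun j hj => (hlt j hj).1)
    fun j hj => (hlt j hj).2).mono le_rfl ?_)
  rintro s3 ⟨rk, pr, h3, hi, hcl⟩
  refine Wp.seq ((wp_select (σ := {σ with rk := rk, pr := pr}) hO h3 huk ?_ ?_).mono le_rfl ?_)
  · have := hi.forest.fst
    dsimp only at this ⊢
    omega
  · intro x hx
    exact (hopt.count x hx).trans_lt ((countBelow_le _ _ _).trans_lt hk)
  rintro s4 ⟨h4, ht, htr, hmin⟩
  obtain ⟨q, hq1, hq2, hr⟩ := hopt.exists_isReversal hi.forest hcl ht htr hmin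
  refine Wp.seq ((wp_reverse (σ := {σ with rk := rk, pr := pr}) h4 rfl hu' hv' hq1 hr).mono ?_ ?_)
  · have := hi.le _ ht htr
    dsimp only at this ⊢
    omega
  rintro s5 ⟨hd, tl, h5, ht5, hr5, hrev⟩
  refine (wp_insert h5).mono le_rfl fun s6 h6 => ⟨_, _, _, _, _, h6, ?_⟩
  rw [ht5]
  exact hrev.isPartialOptimum hF huk hvk hq1 hq2 hr.eq hi.forest.fst hi.forest.snd
    (hi.forest.root _ hrev.lt hr5)

theorem time_insertionProgram_le (n m E : ℕ) :
    1 + m * (1 + 100 * (n + m + 1) ^ 2 * (E + 1)) ≤ 101 * (n + m + 1) ^ 3 * (E + 1) := by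
  have h1 : 1 ≤ (n + m + 1) ^ 2 * (E + 1) := Nat.mul_pos (by positivity) (by positivity)
  calc 1 + m * (1 + 100 * (n + m + 1) ^ 2 * (E + 1))
      ≤ (n + m + 1) ^ 2 * (E + 1) + m * ((n + m + 1) ^ 2 * (E + 1) +
          100 * (n + m + 1) ^ 2 * (E + 1)) := by gcongr
    _ = (101 * m + 1) * ((n + m + 1) ^ 2 * (E + 1)) := by ring
    _ ≤ (101 * (n + m + 1)) * ((n + m + 1) ^ 2 * (E + 1)) := by gcongr; omega
    _ = _ := by ring

theorem wp_insertionProgram (hO : Admissible O S σ.n σ.m E)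
    (hF : ∀ x, Monotone (marginal (O.value x)))
    (hu : ∀ j < σ.m, σ.u j < σ.n) (hv : ∀ j < σ.m, σ.v j < σ.n) (h : σ.Agrees s)
    (hk : σ.k = 0) (hdg : ∀ x, σ.dg x = 0) :
    Wp O S insertionProgram (101 * (σ.n + σ.m + 1) ^ 3 * (E + 1))
      (fun s' => ∃ tl dg, IsPartialOptimum O.value σ.n σ.m σ.u σ.v (s'.nat 3) tl dg) s := by
  refine (Wp.whileDo (N := σ.m) (fun N s => ∃ k hd tl rk pr dg, Data.Agrees
      {σ with k := k, hd := hd, tl := tl, rk := rk, pr := pr, dg := dg} s ∧ k + N = σ.m ∧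
      IsPartialOptimum O.value σ.n k σ.u σ.v hd tl dg)
    ⟨_, _, _, _, _, _, h, by omega, ?_⟩ ?_ ?_).mono
    (time_insertionProgram_le σ.n σ.m E) fun _ h => h
  · rw [hk]
    -- Without edges all indegrees are zero, where the first increment is a subgradient because
    -- there is no lower condition.
    refine ⟨fun j hj => by omega, fun x _ => by simp [hdg, countBelow],
      fun x => marginal (O.value x) 0, fun x _ => ?_, fun j hj => by omega⟩
    rw [hdg]
    exact ⟨le_rfl, fun h => absurd h (lt_irrefl 0)⟩
  · rintro N s ⟨k, hd, tl, rk, pr, dg, h, hN, hopt⟩ hb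
    simp only [Test.holds, NatOperand.value, h.eqs] at hb
    refine (wp_insert_edge (σ := ⟨σ.n, σ.m, k, σ.u, σ.v, hd, tl, rk, pr, dg⟩) hO hF hu hv h hb hopt).mono le_rfl ?_
    rintro s' ⟨hd', tl', rk', pr', dg', h', hopt'⟩
    exact ⟨N - 1, by omega, _, _, _, _, _, _, h', by change k + 1 + (N - 1) = σ.m; omega, hopt'⟩
  · rintro N s ⟨k, hd, tl, rk, pr, dg, h, hN, hopt⟩ hb
    simp only [Test.holds, NatOperand.value, h.eqs] at hb
    obtain rfl : k = σ.m := by omega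
    exact ⟨tl, dg, by rwa [h.hd]⟩

end InsertionProgram

theorem insertionProgram_boundedBy {B : ℕ} (hB : 1 ≤ B) : insertionProgram.BoundedBy B := by
  simp [hB, insertionProgram, InsertionProgram.clear, InsertionProgram.markEnds,
    InsertionProgram.search, InsertionProgram.extend, InsertionProgram.select,
    InsertionProgram.evalMarginal, InsertionProgram.reverse, InsertionProgram.insert,
    Program.BoundedBy, NatOperand.BoundedBy]

end RealRAM

/-! ### From numbers back to the graph, and the size of the real data. -/

namespace Graph.Listing

open RealRAM InsertionProgram

variable {α : Type u} {β : Type v} {G : Graph α β} {n m : ℕ}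

theorem exists_isOptimal [Fintype V(G)] (L : G.Listing n m) {φ : V(G) → ℕ → ℝ}
    (hφ : ∀ x, DiscreteConvex (φ x)) (τ : V(G) → ℕ → ℕ) {s : Memory} {tl dg : ℕ → ℕ}
    (h : IsPartialOptimum (L.evaluator φ τ).value n m (L.input.nat 1) (L.input.nat 2) (s.nat 3)
      tl dg) :
    ∃ D : G.Orientation, D.IsOptimal φ ∧ L.IsOutput D s := by
  have : Fintype E(G) := Fintype.ofEquiv _ L.edge
  have hor : ∀ j : Fin m, (s.nat 3 j = L.fst j ∧ tl j = L.snd j) ∨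
      (s.nat 3 j = L.snd j ∧ tl j = L.fst j) := fun j => by
    simpa [input] using h.oriented j j.2
  have hlt : ∀ j : Fin m, s.nat 3 j < n ∧ tl j < n := fun j => by
    rcases hor j with h | h <;> rw [h.1, h.2] <;> simp
  let D : G.Orientation :=
    { tail := fun e => L.vertex ⟨tl (L.edge.symm e), (hlt _).2⟩
      head := fun e => L.vertex ⟨s.nat 3 (L.edge.symm e), (hlt _).1⟩
      isLink := fun e => by
        have hl := L.isLink (L.edge.symm e)
        rw [Equiv.apply_symm_apply] at hl
        rcases hor (L.edge.symm e) with h | h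
        · simpa only [h.1, h.2] using hl.symm
        · simpa only [h.1, h.2] using hl }
  have hdeg : ∀ x : Fin n, D.indegree (L.vertex x) = dg x := fun x => by
    rw [h.count x x.2, countBelow, Finset.sum_range, ← Finset.card_filter]
    -- The numbering of the edges carries the edge numbers with head `x` to the edges entering the
    -- vertex numbered `x`.
    have : {e | D.head e = L.vertex x} = L.edge '' {j | s.nat 3 j = x} := by
      ext e
      simp [D, L.edge.image_eq_preimage_symm, Fin.ext_iff]
    rw [Orientation.indegree, this, Set.ncard_image_of_injective _ L.edge.injective,
      Set.ncard_eq_toFinset_card', Set.toFinset_ofPred]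
  obtain ⟨p, hp, hpa⟩ := h.potential
  refine ⟨D, D.isOptimal_of_potential hφ (fun x => p (L.vertex.symm x)) (fun x => ?_) fun e => ?_,
    fun j => ?_⟩
  · obtain ⟨x, rfl⟩ := L.vertex.surjective x
    rw [hdeg]
    simpa [evaluator] using hp x x.2
  · simpa [D] using hpa (L.edge.symm e) (L.edge.symm e).2
  · simp [D]

theorem input_nat_le (L : G.Listing n m) (a i : ℕ) : L.input.nat a i ≤ n + m + 1 := by
  simp only [input]
  split
  · omega
  · omega
  · split_ifs
    · have := (L.fst ⟨_, ‹_›⟩).2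
      omega
    · omega
  · split_ifs
    · have := (L.snd ⟨_, ‹_›⟩).2
      omega
    · omega
  · omega

/-- The numbers of a size linear in the size of the data. -/
def sizeLinear (n m : ℕ) (F : ℕ → ℕ → ℝ) : Set ℝ :=
  {c | ∀ b, (∀ x < n, ∀ z ≤ m, HasRatSizeLE (F x z) b) → HasRatSizeLE c (4 * b + 1)}

theorem admissible_evaluator (L : G.Listing n m) {φ : V(G) → ℕ → ℝ} {τ : V(G) → ℕ → ℕ} {E : ℕ}
    (hτ : ∀ x z, z ≤ m → τ x z ≤ E) :
    Admissible (L.evaluator φ τ) (sizeLinear n m (L.evaluator φ τ).value) n m E where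
  value_mem x hx z hz b hb := (hb x hx z hz).mono (by omega)
  marginal_mem x hx z hz b hb := ((hb x hx (z + 1) hz).sub (hb x hx z hz.le)).mono (by omega)
  time_le x hx z hz := by simpa [evaluator, hx] using hτ _ z hz

end Graph.Listing

/-! ### Assembly with explicit polynomials. -/

theorem mainTheorem8 :
    -- a single program for all graphs and all functions
    ∃ P : RealRAM.Program,
    -- whenever evaluation times are bounded by a polynomial of |V| and |E|, so is the running time
    ∀ evalBound : Polynomial ℕ, ∃ timeBound sizeBound : Polynomial ℕ,
    ∀ (α : Type u) (β : Type v) (G : Graph α β) [G.Loopless] [Fintype V(G)]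
      (n m : ℕ) (L : G.Listing n m)
      (φ : V(G) → ℕ → ℝ) (_ : ∀ x : V(G), DiscreteConvex (φ x))
      (τ : V(G) → ℕ → ℕ) (_ : ∀ (x : V(G)) (z : ℕ), z ≤ m → τ x z ≤ evalBound.eval (n + m)),
    ∃ T : ℕ,
      -- the program halts with an optimal orientation in its memory
      (RealRAM.configAt (L.evaluator φ τ) P L.input T).todo = [] ∧
      (∃ D : G.Orientation, D.IsOptimal φ ∧
        L.IsOutput D (RealRAM.configAt (L.evaluator φ τ) P L.input T).mem) ∧
      -- its running time, evaluations included, is polynomial in |V| and |E|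
      RealRAM.timeUntil (L.evaluator φ τ) P L.input T ≤ timeBound.eval (n + m) ∧
      -- the natural numbers used for indexing and counting have polynomially many digits
      (∀ t ≤ T, ∀ a i : ℕ,
        ((RealRAM.configAt (L.evaluator φ τ) P L.input t).mem.nat a i).size
          ≤ sizeBound.eval (n + m)) ∧
      -- if the data are rational with at most b digits each, then all numbers computed are rational
      -- with a number of digits that is polynomial in |V|, |E| and b
      (∀ b : ℕ, (∀ (x : V(G)) (z : ℕ), z ≤ m → HasRatSizeLE (φ x z) b) →
        ∀ t ≤ T, ∀ a i : ℕ,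
          HasRatSizeLE ((RealRAM.configAt (L.evaluator φ τ) P L.input t).mem.real a i)
            (sizeBound.eval (n + m + b))) := by
  refine ⟨RealRAM.insertionProgram, fun evalBound => ?_⟩
  let timeBound : Polynomial ℕ := 101 * (Polynomial.X + 1) ^ 3 * (evalBound + 1)
  -- The size bound covers `T + (n + m + 1)` digits for natural numbers, from `2 ^ T * (n + m + 1)`,
  -- and `4 * b + 1` digits for real ones.
  refine ⟨timeBound, timeBound + 4 * Polynomial.X + 1, ?_⟩
  intro α β G _ _ n m L φ hφ τ hτ
  set O := L.evaluator φ τ with hOdef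
  let σ : RealRAM.InsertionProgram.Data :=
    ⟨n, m, 0, L.input.nat 1, L.input.nat 2, fun _ => 0, fun _ => 0, fun _ => 0, fun _ => 0,
      fun _ => 0⟩
  have hF : ∀ x, Monotone (marginal (O.value x)) := fun x => by
    by_cases hx : x < n
    · have : O.value x = φ (L.vertex ⟨x, hx⟩) := by ext z; simp [O, Graph.Listing.evaluator, hx]
      rw [this]
      exact (hφ _).monotone_marginal
    -- Arguments that are not vertex numbers return zero, which is also convex.
    · have : marginal (O.value x) = fun _ => 0 := by ext z; simp [O, Graph.Listing.evaluator, hx, marginal]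
      rw [this]
      exact monotone_const
  have hagree : σ.Agrees L.input := by constructor <;> rfl
  -- The set quantifies over `b` internally, so a single run serves all `b`, and it imposes nothing
  -- when the data are not all rational.
  have hin : L.input.RealIn (Graph.Listing.sizeLinear n m O.value) := fun _ _ b _ =>
    hasRatSizeLE_zero.mono (by omega)
  obtain ⟨s', ⟨tl, dg, hopt⟩, hrun⟩ := RealRAM.InsertionProgram.wp_insertionProgram (σ := σ)
    (L.admissible_evaluator hτ) hF (fun j hj => by simp [σ, Graph.Listing.input, show j < m from hj])
    (fun j hj => by simp [σ, Graph.Listing.input, show j < m from hj]) hagree rfl (fun _ => rfl) hin []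
  obtain ⟨T, hT, hc, htime, hreal⟩ := hrun.exists_iterate
  have hcT : RealRAM.configAt O RealRAM.insertionProgram L.input T = ⟨[], s'⟩ := hc
  have heval : timeBound.eval (n + m) = 101 * (n + m + 1) ^ 3 * (evalBound.eval (n + m) + 1) := by
    simp [timeBound]
  refine ⟨T, by rw [hcT], ?_, htime.trans heval.ge, fun t ht a i => ?_, fun b hb t ht a i => ?_⟩
  · rw [hcT]
    exact L.exists_isOptimal hφ τ hopt
  · have h1 := RealRAM.configAt_nat_le (O := O)
      (RealRAM.insertionProgram_boundedBy (Nat.le_add_left 1 (n + m))) L.input_nat_le t a i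
    have h2 : (timeBound + 4 * Polynomial.X + 1).eval (n + m) = timeBound.eval (n + m) + 4 * (n + m) + 1 := by
      simp
    have h3 : 2 ^ t * (n + m + 1) < 2 ^ (t + (n + m + 1)) := by
      rw [pow_add]
      exact Nat.mul_lt_mul_of_pos_left Nat.lt_two_pow_self (by positivity)
    have h4 := Nat.size_le.2 (h1.trans_lt h3)
    have h5 : T ≤ timeBound.eval (n + m) := hT.trans heval.ge
    omega
  · have h1 := hreal t ht a i b fun x hx z hz => by
      simpa [O, Graph.Listing.evaluator, hx] using hb _ z hz
    refine h1.mono ?_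
    simp
    omega
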